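/- Let $A$ be a commutative ring with unit (possibly trivial) which is reduced. Let $X=\mathrm{Spec}(A)$ be the spectrum of $A$ and let $A^\sim=\mathcal{O}_{\mathrm{Spec}(A)}$ be its structure sheaf, that is, the localization of the constant sheaf $\underline{A}$ at the generic prime filter of $A$. Then the sheaf of rings $A^\sim$ is \emph{anonymously Noetherian}: in the (higher-order, Kripke--Joyal) sheaf semantics over $X$, every ideal of $A^\sim$ is not not finitely generated, i.e. $$\mathrm{Sh}(X)\models \forall \mathfrak{a}:\mathcal{P}(A^\sim).\ \bigl(\mathfrak{a}\text{ is an ideal}\Rightarrow \neg\neg(\mathfrak{a}\text{ is finitely generated})\bigr).$$ Here "$\mathfrak{a}$ is an ideal" is the formula $0\in\mathfrak{a}\wedge\forall x,y:A^\sim.\,(x\in\mathfrak{a}\wedge y\in\mathfrak{a}\Rightarrow x+y\in\mathfrak{a})\wedge\forall x,y:A^\sim.\,(x\in\mathfrak{a}\Rightarrow xy\in\mathfrak{a})$, and "$\mathfrak{a}$ is finitely generated" is the formula $$\bigvee_{n\in\mathbb{N}}\exists x_1,\ldots,x_n:A^\sim.\ \Bigl(\bigwedge_{i=1}^n x_i\in\mathfrak{a}\Bigr)\wedge\forall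 y:A^\sim.\ \bigl(y\in\mathfrak{a}\Leftrightarrow\exists c_1,\ldots,c_n:A^\sim.\ y=c_1x_1+\cdots+c_nx_n\bigr).$$ The forcing relation $U\models\varphi$ (for $U\subseteq X$ open) is defined by recursion on $\varphi$: equality and membership of sections are evaluated over $U$; $U\models\bot$ iff $U=\emptyset$; $U\models\varphi\wedge\psi$ iff $U\models\varphi$ and $U\models\psi$, and likewise for infinite conjunctions; $U\models\varphi\Rightarrow\psi$ iff for all open $V\subseteq U$, $V\models\varphi$ implies $V\models\psi$; $U\models\bigvee_k\varphi_k$ iff there is an open covering $U=\bigcup_iU_i$ such that for each $i$ there is a $k$ with $U_i\models\varphi_k$; $U\models\forall s:F.\,\varphi(s)$ iff $V\models\varphi(s)$ for all open $V\subseteq U$ and all $s\in F(V)$; $U\models\exists s:F.\,\varphi(s)$ iff there is an open covering $U=\bigcup_iU_i$ such that for each $i$ there is an $s\in F(U_i)$ with $U_i\models\varphi(s)$. The quantifier over $\mathcal{P}(A^\sim)$ uses the power sheaf, whose sections over $U$ are the subsheaves of sets $\mathfrak{a}$ of $A^\sim|_U$, with $U\models s\in\mathfrak{a}$ iff $s\in\mathfrak{a}(U)$.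 Further, $\neg\varphi$ abbreviates $\varphi\Rightarrow\bot$, and $\mathrm{Sh}(X)\models\varphi$ means $X\models\varphi$. -/

import Mathlib

open CategoryTheory Opposite TopologicalSpace

universe u

namespace SheafSemantics

/-! ### The language

Infinitary higher-order formulas in the language of commutative rings. There are two sorts: the
ring `R` and its power sort `P(R)`. Variables are de Bruijn levels: a formula in
`Formula m k` has free variables `x₀, …, x_{m-1} : R` and `a₀, …, a_{k-1} : P(R)`; a quantifier
over `R` (over `P(R)`) binds the variable `x_m` (the variable `a_k`) of its body. -/

/-- Terms of sort `R`, that is polynomial expressions with integer coefficients in the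
variables of sort `R`. -/
abbrev RingTerm (m : ℕ) : Type := MvPolynomial (Fin m) ℤ

/-- Formulas with `m` free variables of sort `R` and `k` free variables of sort `P(R)`. -/
inductive Formula : ℕ → ℕ → Type 1
  | eq {m k : ℕ} (s t : RingTerm m) : Formula m k
  | mem {m k : ℕ} (s : RingTerm m) (a : Fin k) : Formula m k
  | top {m k : ℕ} : Formula m k
  | bot {m k : ℕ} : Formula m k
  | and {m k : ℕ} (φ ψ : Formula m k) : Formula m k
  | or {m k : ℕ} (φ ψ : Formula m k) : Formula m k
  | imp {m k : ℕ} (φ ψ : Formula m k) : Formula m k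
  | bigAnd {m k : ℕ} (J : Type) (φ : J → Formula m k) : Formula m k
  | bigOr {m k : ℕ} (J : Type) (φ : J → Formula m k) : Formula m k
  | all {m k : ℕ} (φ : Formula (m + 1) k) : Formula m k
  | ex {m k : ℕ} (φ : Formula (m + 1) k) : Formula m k
  | allSet {m k : ℕ} (φ : Formula m (k + 1)) : Formula m k
  | exSet {m k : ℕ} (φ : Formula m (k + 1)) : Formula m k

namespace Formula

/-- `¬ φ` abbreviates `φ ⇒ ⊥`. -/
def neg {m k : ℕ} (φ : Formula m k) : Formula m k := imp φ bot

/-- `φ ⇔ ψ` abbreviates `(φ ⇒ ψ) ∧ (ψ ⇒ φ)`. -/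
def iff {m k : ℕ} (φ ψ : Formula m k) : Formula m k := and (imp φ ψ) (imp ψ φ)

/-- `∃ x_m … x_{m+n-1} : R. φ`. -/
def exs {m k : ℕ} : (n : ℕ) → Formula (m + n) k → Formula m k
  | 0, φ => φ
  | n + 1, φ => exs n (ex φ)

end Formula

open Formula

/-- "The subset `a` of the ring is an ideal":
`0 ∈ a`, `∀ x y. x ∈ a ∧ y ∈ a ⇒ x + y ∈ a` and `∀ x y. x ∈ a ⇒ x y ∈ a`. -/
noncomputable def isIdeal {m k : ℕ} (a : Fin k) : Formula m k :=
  let x : RingTerm (m + 1 + 1) := MvPolynomial.X (Fin.castSucc (Fin.last m))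
  let y : RingTerm (m + 1 + 1) := MvPolynomial.X (Fin.last (m + 1))
  and (mem 0 a)
    (and (all (all (imp (and (mem x a) (mem y a)) (mem (x + y) a))))
      (all (all (imp (mem x a) (mem (x * y) a)))))

/-- "The ideal `a` is generated by finitely many of its elements":
`⋁ n, ∃ x₁ … xₙ. (⋀ i, xᵢ ∈ a) ∧ ∀ y. (y ∈ a ⇔ ∃ c₁ … cₙ. y = c₁ x₁ + ⋯ + cₙ xₙ)`. -/
noncomputable def isFinitelyGenerated {m k : ℕ} (a : Fin k) : Formula m k :=
  bigOr ℕ fun n => exs n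
    (and (bigAnd (Fin n) fun i => mem (MvPolynomial.X (Fin.natAdd m i)) a)
      (all (iff (mem (MvPolynomial.X (Fin.last (m + n))) a)
        (exs n (eq (MvPolynomial.X (Fin.castAdd n (Fin.last (m + n))))
          (∑ i : Fin n, MvPolynomial.X (Fin.natAdd (m + n + 1) i) *
            MvPolynomial.X (Fin.castAdd n (Fin.castSucc (Fin.natAdd m i)))))))))

/-- "The ring is anonymously Noetherian": every ideal is not not finitely generated,
`∀ a : P(R). (a is an ideal ⇒ ¬¬ (a is finitely generated))`. -/
noncomputable def anonymouslyNoetherian : Formula 0 0 :=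
  allSet (imp (isIdeal (Fin.last 0)) (neg (neg (isFinitelyGenerated (Fin.last 0)))))

/-! ### The sheaf semantics -/

variable {X : TopCat.{u}} (𝒪 : TopCat.Sheaf CommRingCat.{u} X)

/-- The ring of sections of `𝒪` over `U`. -/
abbrev Sections (U : Opens X) : Type u := 𝒪.presheaf.obj (op U)

/-- Restriction of sections. -/
def res {U V : Opens X} (h : V ≤ U) : Sections 𝒪 U →+* Sections 𝒪 V :=
  (𝒪.presheaf.map (homOfLE h).op).hom

/-- Subsheaves (of sets) of the restriction of the sheaf `𝒪` to the open `U`. These are the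
sections over `U` of the power sheaf of `𝒪`. As `𝒪` is a sheaf, a subpresheaf of `𝒪|_U` is a sheaf
if and only if membership in it is a local condition. -/
structure SubsheafOver (U : Opens X) where
  /-- The sections over `V ≤ U` of the subsheaf. -/
  carrier : ∀ V : Opens X, V ≤ U → Set (Sections 𝒪 V)
  res_mem : ∀ (V W : Opens X) (hV : V ≤ U) (hW : W ≤ V) (s : Sections 𝒪 V),
    s ∈ carrier V hV → res 𝒪 hW s ∈ carrier W (hW.trans hV)
  local_mem : ∀ (V : Opens X) (hV : V ≤ U) (I : Type u) (W : I → Opens X) (hW : ∀ i, W i ≤ V),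
    iSup W = V → ∀ s : Sections 𝒪 V,
      (∀ i, res 𝒪 (hW i) s ∈ carrier (W i) ((hW i).trans hV)) → s ∈ carrier V hV

/-- Restriction of a subsheaf of `𝒪|_U` to a smaller open. -/
def SubsheafOver.restrict {U V : Opens X} (h : V ≤ U) (a : SubsheafOver 𝒪 U) :
    SubsheafOver 𝒪 V where
  carrier W hW := a.carrier W (hW.trans h)
  res_mem V' W hV hW s hs := a.res_mem V' W (hV.trans h) hW s hs
  local_mem V' hV I W hW hc s hs := a.local_mem V' (hV.trans h) I W hW hc s hs

/-- The sheaf semantics (Kripke–Joyal semantics): `Forces 𝒪 φ U x a` means `U ⊨ φ(x, a)`, where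
the sorts `R` and `P(R)` are interpreted by `𝒪` and its power sheaf, and the free variables of `φ`
are interpreted by the sections `x` of `𝒪` over `U` and the sections `a` of the power sheaf
over `U`. -/
def Forces : {m k : ℕ} → Formula m k → (U : Opens X) →
    (Fin m → Sections 𝒪 U) → (Fin k → SubsheafOver 𝒪 U) → Prop
  | _, _, .eq s t, _, x, _ => MvPolynomial.aeval x s = MvPolynomial.aeval x t
  | _, _, .mem s j, U, x, a => MvPolynomial.aeval x s ∈ (a j).carrier U le_rfl
  | _, _, .top, _, _, _ => True
  | _, _, .bot, U, _, _ => U = ⊥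
  | _, _, .and φ ψ, U, x, a => Forces φ U x a ∧ Forces ψ U x a
  | _, _, .or φ ψ, U, x, a =>
      ∃ (I : Type u) (W : I → Opens X) (hW : ∀ i, W i ≤ U), iSup W = U ∧
        ∀ i, Forces φ (W i) (fun l => res 𝒪 (hW i) (x l)) (fun l => (a l).restrict 𝒪 (hW i)) ∨
          Forces ψ (W i) (fun l => res 𝒪 (hW i) (x l)) (fun l => (a l).restrict 𝒪 (hW i))
  | _, _, .imp φ ψ, U, x, a =>
      ∀ (V : Opens X) (hV : V ≤ U),
        Forces φ V (fun l => res 𝒪 hV (x l)) (fun l => (a l).restrict 𝒪 hV) →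
          Forces ψ V (fun l => res 𝒪 hV (x l)) (fun l => (a l).restrict 𝒪 hV)
  | _, _, .bigAnd J φ, U, x, a => ∀ j : J, Forces (φ j) U x a
  | _, _, .bigOr J φ, U, x, a =>
      ∃ (I : Type u) (W : I → Opens X) (hW : ∀ i, W i ≤ U), iSup W = U ∧
        ∀ i, ∃ j : J,
          Forces (φ j) (W i) (fun l => res 𝒪 (hW i) (x l)) (fun l => (a l).restrict 𝒪 (hW i))
  | _, _, .all φ, U, x, a =>
      ∀ (V : Opens X) (hV : V ≤ U) (s : Sections 𝒪 V),
        Forces φ V (Fin.snoc (α := fun _ => Sections 𝒪 V) (fun l => res 𝒪 hV (x l)) s)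
          (fun l => (a l).restrict 𝒪 hV)
  | _, _, .ex φ, U, x, a =>
      ∃ (I : Type u) (W : I → Opens X) (hW : ∀ i, W i ≤ U), iSup W = U ∧
        ∀ i, ∃ s : Sections 𝒪 (W i),
          Forces φ (W i)
            (Fin.snoc (α := fun _ => Sections 𝒪 (W i)) (fun l => res 𝒪 (hW i) (x l)) s)
            (fun l => (a l).restrict 𝒪 (hW i))
  | _, _, .allSet φ, U, x, a =>
      ∀ (V : Opens X) (hV : V ≤ U) (b : SubsheafOver 𝒪 V),
        Forces φ V (fun l => res 𝒪 hV (x l))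
          (Fin.snoc (α := fun _ => SubsheafOver 𝒪 V) (fun l => (a l).restrict 𝒪 hV) b)
  | _, _, .exSet φ, U, x, a =>
      ∃ (I : Type u) (W : I → Opens X) (hW : ∀ i, W i ≤ U), iSup W = U ∧
        ∀ i, ∃ b : SubsheafOver 𝒪 (W i),
          Forces φ (W i) (fun l => res 𝒪 (hW i) (x l))
            (Fin.snoc (α := fun _ => SubsheafOver 𝒪 (W i))
              (fun l => (a l).restrict 𝒪 (hW i)) b)

/-- `Sh(X) ⊨ φ` for a closed formula `φ` about the sheaf of rings `𝒪`: the largest open of `X`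
forces `φ`. -/
def Holds (φ : Formula 0 0) : Prop :=
  Forces 𝒪 φ ⊤ (fun l => l.elim0) (fun l => l.elim0)

end SheafSemantics

namespace SheafSemantics

open Formula

section General

variable {X : TopCat.{u}} (𝒪 : TopCat.Sheaf CommRingCat.{u} X)

/-! Forcing `¬¬ φ` means that every nonempty open contains a nonempty open forcing `φ`. Over a given
open, an ideal either has only zero sections, hence is generated by the empty family, or has a
nonzero section on some smaller open. By reducedness that section becomes invertible on a nonempty
open (`exists_isUnit_res_of_ne_zero`), where the ideal is the unit ideal, generated by `1`. -/

theorem res_self {U : Opens X} (h : U ≤ U) (s : Sections 𝒪 U) : res 𝒪 h s = s := by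
  simp [res]

variable {𝒪}

theorem zero_mem_of_forces_isIdeal {m k : ℕ} {j : Fin k} {U : Opens X}
    {x : Fin m → Sections 𝒪 U} {a : Fin k → SubsheafOver 𝒪 U}
    (h : Forces 𝒪 (isIdeal j) U x a) {W : Opens X} (hW : W ≤ U) :
    (0 : Sections 𝒪 W) ∈ (a j).carrier W hW := by
  have h0 := h.1
  simp only [Forces, map_zero] at h0
  simpa using (a j).res_mem U W le_rfl hW 0 h0

theorem mul_mem_of_forces_isIdeal {m k : ℕ} {j : Fin k} {U : Opens X}
    {x : Fin m → Sections 𝒪 U} {a : Fin k → SubsheafOver 𝒪 U}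
    (h : Forces 𝒪 (isIdeal j) U x a) {W : Opens X} (hW : W ≤ U) {s : Sections 𝒪 W}
    (hs : s ∈ (a j).carrier W hW) (t : Sections 𝒪 W) : s * t ∈ (a j).carrier W hW := by
  -- Both quantifiers and the implication are evaluated over the same `W`, so the later restrictions
  -- are identities.
  have key := h.2.2 W hW s W le_rfl t W le_rfl
  simp only [Forces, map_mul, MvPolynomial.aeval_X, Fin.snoc_castSucc, Fin.snoc_last,
    res_self] at key
  exact key hs

/-- The zero ideal is finitely generated, by the empty family. -/
theorem forces_isFinitelyGenerated_of_forall_eq_zero {m k : ℕ} {j : Fin k} {U : Opens X}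
    {x : Fin m → Sections 𝒪 U} {a : Fin k → SubsheafOver 𝒪 U}
    (h : ∀ (W : Opens X) (hW : W ≤ U) (s : Sections 𝒪 W), s ∈ (a j).carrier W hW ↔ s = 0) :
    Forces 𝒪 (isFinitelyGenerated j) U x a := by
  refine ⟨PUnit, fun _ => U, fun _ => le_rfl, iSup_const, fun _ => ⟨0, fun i => i.elim0, ?_⟩⟩
  intro V hV s
  constructor
  · intro W hW hs
    simp only [Forces, MvPolynomial.aeval_X] at hs
    have hs' := (h W (hW.trans hV) _).1 hs
    simpa [exs, Forces] using hs'
  · intro W hW hs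
    simp only [Forces, MvPolynomial.aeval_X]
    refine (h W (hW.trans hV) _).2 ?_
    simpa [exs, Forces] using hs

/-- The unit ideal is finitely generated, by `1`. -/
theorem forces_isFinitelyGenerated_of_forall_mem {m k : ℕ} {j : Fin k} {U : Opens X}
    {x : Fin m → Sections 𝒪 U} {a : Fin k → SubsheafOver 𝒪 U}
    (h : ∀ (W : Opens X) (hW : W ≤ U) (s : Sections 𝒪 W), s ∈ (a j).carrier W hW) :
    Forces 𝒪 (isFinitelyGenerated j) U x a := by
  -- This `1` is the number of generators; the next one is the generator itself.
  refine ⟨PUnit, fun _ => U, fun _ => le_rfl, iSup_const, fun _ => ⟨1, ?_⟩⟩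
  refine ⟨PUnit, fun _ => U, fun _ => le_rfl, iSup_const, fun _ => ⟨1, fun i => h U le_rfl _, ?_⟩⟩
  intro V hV s
  constructor
  · intro W hW _
    -- As the generator is `1`, the coefficient is the section itself.
    refine ⟨PUnit, fun _ => W, fun _ => le_rfl, iSup_const, fun _ => ⟨res 𝒪 hW s, ?_⟩⟩
    simpa [Forces, Fin.snoc, Fin.natAdd, Fin.castAdd] using res_self 𝒪 le_rfl (res 𝒪 hW s)
  · intro W hW _
    exact h W (hW.trans hV) _

end General

/-- On the spectrum of a reduced ring, a nonzero section becomes invertible on a nonempty open. -/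
theorem exists_isUnit_res_of_ne_zero {A : Type u} [CommRing A] [IsReduced A]
    {U : Opens (AlgebraicGeometry.PrimeSpectrum.Top A)}
    {s : Sections (AlgebraicGeometry.Spec.structureSheaf A) U} (hs : s ≠ 0) :
    ∃ (V : Opens (AlgebraicGeometry.PrimeSpectrum.Top A)) (hV : V ≤ U), V ≠ ⊥ ∧
      IsUnit (res (AlgebraicGeometry.Spec.structureSheaf A) hV s) := by
  let S := AlgebraicGeometry.Spec (CommRingCat.of A)
  let s' : S.presheaf.obj (op U) := s
  -- The open is the locus where the germ of `s` is a unit. Reducedness makes it nonempty: on a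
  -- reduced scheme only the zero section has empty locus.
  refine ⟨S.basicOpen s', S.basicOpen_le s', ?_, ?_⟩
  · intro h
    exact hs (AlgebraicGeometry.basicOpen_eq_bot_iff s' |>.1 h)
  · exact AlgebraicGeometry.RingedSpace.isUnit_res_basicOpen S.toRingedSpace s'

theorem holds_anonymouslyNoetherian (A : Type u) [CommRing A] [IsReduced A] :
    Holds (AlgebraicGeometry.Spec.structureSheaf A) anonymouslyNoetherian := by
  intro U _ a U' hU' hI V hV hfg
  -- A classical case split outside the sheaf semantics; no internal decidability is claimed.
  by_cases hzero : ∀ (W : Opens _) (hW : W ≤ V) (s : Sections _ W),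
      s ∈ a.carrier W ((hW.trans hV).trans hU') → s = 0
  · refine hfg V le_rfl (forces_isFinitelyGenerated_of_forall_eq_zero fun W hW s => ⟨?_, ?_⟩)
    · exact hzero W hW s
    · rintro rfl
      exact zero_mem_of_forces_isIdeal hI (hW.trans hV)
  · push Not at hzero
    obtain ⟨W, hW, s, hs, hne⟩ := hzero
    obtain ⟨W', hW', hbot, hu⟩ := exists_isUnit_res_of_ne_zero hne
    refine absurd (hfg W' (hW'.trans hW) ?_) hbot
    refine forces_isFinitelyGenerated_of_forall_mem fun W₁ hW₁ t => ?_
    have hu' := hu.map (res _ hW₁)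
    obtain ⟨v, hv⟩ := hu'.exists_right_inv
    have hmem := a.res_mem _ W₁ _ hW₁ _ (a.res_mem W W' _ hW' s hs)
    -- With `v` inverse to the restriction of `s`, any `t` equals `s * (v * t)`.
    have := mul_mem_of_forces_isIdeal hI (((hW₁.trans hW').trans hW).trans hV) hmem (v * t)
    rwa [← mul_assoc, hv, one_mul] at this

end SheafSemantics

theorem mainTheorem9 (A : Type u) [CommRing A] [IsReduced A] :
    SheafSemantics.Holds (AlgebraicGeometry.Spec.structureSheaf A)
      SheafSemantics.anonymouslyNoetherian := by
  exact SheafSemantics.holds_anonymouslyNoetherian A
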